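/- Theorem 15.1 (Whitney). Let $L$ be a finite geometric lattice, i.e. a finite bounded lattice in which every element is a join of points (atoms) and which is semimodular: whenever $a$ covers $a\wedge b$, the element $a\vee b$ covers $b$. Let $r(a)$ be the rank of $a\in L$ (the maximum length of a chain ending at $a$), let $\mu_L$ be the Möbius function of $L$, and let $\unlhd$ be a total order on the set of points of $L$. A set $T$ of points is independent if $r(\bigvee T)=|T|$, and dependent otherwise; a circuit is an inclusion-minimal dependent set of points; a broken circuit is a set obtained from a circuit by deleting its $\unlhd$-least element. The faces of the broken circuit complex $\mathrm{Br}(L)$ are the independent sets of points (including the empty set) that contain no broken circuit. Then for every integer $k\ge 0$, $$\bigl|\{T\in \mathrm{Br}(L) : |T|=k\}\bigr| \;=\; \sum_{a\in L:\ r(a)=k} (-1)^k\,\mu_L(0,a).$$ In particular, with $r=r(1)$ the rank of $L$, the number of faces of $\mathrm{Br}(L)$ with exactly $r$ points is $(-1)^{r}\mu_L(0,1)$. Moreover, these faces are exactly the faces of $\mathrm{Br}(L)$ of maximum cardinality, so $(-1)^r\mu_L(0,1)$ is the number of top-dimensional faces of the broken circuit complex. -/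

import Mathlib

namespace GeometricLattice

/-- A bounded lattice is geometric if it is (upper) semimodular and every element is a join of
points (atoms). -/
class IsGeometric (L : Type*) [Lattice L] [BoundedOrder L] : Prop where
  semimodular : IsUpperModularLattice L
  pointLattice : IsAtomistic L

/-- The points (atoms) of a lattice. -/
abbrev Point (L : Type*) [Lattice L] [BoundedOrder L] : Type _ := {p : L // IsAtom p}

variable {L : Type*} [Lattice L] [BoundedOrder L]

/-- The rank of `a`: the maximum length of a chain ending at `a`
(chains in a finite lattice have bounded length, so no information is lost by `toNat`). -/
noncomputable def rank (a : L) : ℕ := (Order.height a).toNat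

/-- The rank of a finite set of points, i.e. the rank of its join. -/
noncomputable def setRank (T : Finset (Point L)) : ℕ := rank (T.sup Subtype.val)

/-- A finite set of points is independent if its rank equals its cardinality. -/
def Indep (T : Finset (Point L)) : Prop := setRank T = T.card

/-- A circuit is an inclusion-minimal dependent set of points. -/
def IsCircuit (C : Finset (Point L)) : Prop := Minimal (fun T => ¬ Indep T) C

/-- A broken circuit, relative to the order `le` on points, is obtained from a circuit by
deleting its least element. -/
def IsBrokenCircuit (le : Point L → Point L → Prop) (B : Finset (Point L)) : Prop :=
  ∃ C : Finset (Point L), IsCircuit C ∧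
    ∃ p ∈ C, (∀ q ∈ C, le p q) ∧ (B : Set (Point L)) = (C : Set (Point L)) \ {p}

/-- The faces of the broken circuit complex: the independent sets of points that contain no
broken circuit. The empty set is a face. -/
def brokenCircuitComplex (le : Point L → Point L → Prop) : Set (Finset (Point L)) :=
  {T | Indep T ∧ ∀ B : Finset (Point L), IsBrokenCircuit le B → ¬ B ⊆ T}

/-- The faces of maximum dimension, i.e. of maximum cardinality. -/
def topFaces (le : Point L → Point L → Prop) : Set (Finset (Point L)) :=
  {T | T ∈ brokenCircuitComplex le ∧ ∀ U ∈ brokenCircuitComplex le, U.card ≤ T.card}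

end GeometricLattice

open Finset Order

namespace GeometricLattice

/-! Fix `a ≠ ⊥` and let `p` be the least point below `a`. The faces with join at most `a` form a
cone with apex `p` (`insert_mem_brokenCircuitComplex`), so toggling `p` cancels the sum of `(-1) ^
|T|` over them. A face with join `b` is independent, hence has `rank b` points; grouping faces by
join, `(-1) ^ rank b` times the number of faces with join `b` satisfies the recursion that
determines `μ(⊥, b)`. Every element is the join of a face (`exists_face_sup_eq`), so the maximum
cardinality is the rank of `⊤`. -/

instance {L : Type*} [Lattice L] [BoundedOrder L] [h : IsGeometric L] :
    IsUpperModularLattice L := h.semimodular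

instance {L : Type*} [Lattice L] [BoundedOrder L] [h : IsGeometric L] :
    IsAtomistic L := h.pointLattice

/-- `CoverPath n a b` says that there is a saturated chain of length `n` from `a` to `b`. -/
inductive CoverPath {α : Type*} [Preorder α] : ℕ → α → α → Prop
  | refl (a : α) : CoverPath 0 a a
  | cons {a b c : α} {n : ℕ} : a ⋖ b → CoverPath n b c → CoverPath (n + 1) a c

/-! ### Saturated chains and the Jordan–Dedekind condition. -/

namespace CoverPath

theorem le {α : Type*} [Preorder α] {n : ℕ} {a b : α} (h : CoverPath n a b) : a ≤ b := by
  induction h with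
  | refl => exact le_rfl
  | cons h _ ih => exact h.le.trans ih

theorem trans {α : Type*} [Preorder α] {m n : ℕ} {a b c : α}
    (h : CoverPath m a b) (h' : CoverPath n b c) : CoverPath (n + m) a c := by
  induction h with
  | refl => exact h'
  | cons h _ ih => exact .cons h (ih h')

/-- If the chain starts with `z ≠ b`, semimodularity makes `b ⊔ z` cover both. By induction the part
from `z` can be rerouted through `b ⊔ z`, and then started at `b` instead. -/
theorem tail_of_covBy {α : Type*} [Lattice α] [IsUpperModularLattice α] {n : ℕ} {a b c : α}
    (h : CoverPath n a c) (hab : a ⋖ b) (hbc : b ≤ c) :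
    ∃ m, n = m + 1 ∧ CoverPath m b c := by
  induction h generalizing b with
  | refl => exact absurd hbc hab.lt.not_ge
  | @cons a z c n haz hzc ih =>
    by_cases hzb : z = b
    · exact ⟨n, rfl, hzb ▸ hzc⟩
    have hinf : z ⊓ b = a :=
      (haz.eq_or_eq (le_inf haz.le hab.le) inf_le_left).resolve_right fun h =>
        (hab.eq_or_eq haz.le (inf_eq_left.1 h)).elim haz.lt.ne' hzb
    have h₁ : z ⋖ b ⊔ z := covBy_sup_of_inf_covBy_left (by rwa [inf_comm, hinf])
    have h₂ : b ⋖ b ⊔ z := by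
      rw [sup_comm]
      exact covBy_sup_of_inf_covBy_left (by rwa [hinf])
    obtain ⟨m, rfl, hm⟩ := ih h₁ (sup_le hbc hzc.le)
    exact ⟨m + 1, rfl, .cons h₂ hm⟩

/-- The Jordan–Dedekind chain condition for semimodular lattices. -/
theorem length_unique {α : Type*} [Lattice α] [IsUpperModularLattice α] {m n : ℕ} {a b : α}
    (h : CoverPath m a b) (h' : CoverPath n a b) : m = n := by
  induction h generalizing n with
  | refl a =>
    cases h' with
    | refl => rfl
    | cons h h' => exact absurd h'.le h.lt.not_ge
  | cons h hp ih =>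
    obtain ⟨k, rfl, hk⟩ := h'.tail_of_covBy h hp.le
    rw [ih hk]

theorem exists_of_le {α : Type*} [PartialOrder α] [Finite α] {a b : α} (hab : a ≤ b) :
    ∃ n, CoverPath n a b := by
  induction a using WellFoundedGT.induction with
  | _ a ih =>
    rcases hab.eq_or_lt with rfl | hlt
    · exact ⟨0, .refl _⟩
    · obtain ⟨c, hac, hcb⟩ := exists_covBy_le_of_lt hlt
      obtain ⟨n, hn⟩ := ih c hac.lt hcb
      exact ⟨n + 1, .cons hac hn⟩

theorem add_height_le {α : Type*} [Preorder α] {n : ℕ} {a b : α} (h : CoverPath n a b) :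
    height a + n ≤ height b := by
  induction h with
  | refl => simp
  | @cons a b c n h _ ih =>
    calc height a + ((n + 1 : ℕ) : ℕ∞) = height a + 1 + n := by push_cast; ring
      _ ≤ height b + n := by gcongr; exact height_add_one_le h.lt
      _ ≤ height c := ih

/-- Height ranges over all chains, not only saturated ones; the upper bound holds because the length
of saturated chains from `⊥` is a strictly monotone function. -/
theorem rank_eq {L : Type*} [Lattice L] [BoundedOrder L] [Finite L] [IsUpperModularLattice L]
    {n : ℕ} {a : L} (h : CoverPath n ⊥ a) : rank a = n := by
  choose r hr using fun x : L => exists_of_le (bot_le : ⊥ ≤ x)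
  have hmono : StrictMono r := fun x y hxy => by
    obtain ⟨k, hk⟩ := exists_of_le hxy.le
    have hlen := (hr y).length_unique ((hr x).trans hk)
    rcases hk with _ | _
    · exact absurd hxy (lt_irrefl _)
    · omega
  have hle : height a ≤ n := by
    have := height_le_height_apply_of_strictMono r hmono a
    rwa [height_nat, (hr a).length_unique h] at this
  have hge : (n : ℕ∞) ≤ height a := by simpa using h.add_height_le
  rw [rank, le_antisymm hle hge, ENat.toNat_natCast]

end CoverPath

/-! ### The rank function. -/

section Rank

variable {L : Type*} [Lattice L] [BoundedOrder L] [Finite L] [IsUpperModularLattice L]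

theorem rank_eq_of_covBy {a b : L} (h : a ⋖ b) : rank b = rank a + 1 := by
  obtain ⟨n, hn⟩ := CoverPath.exists_of_le (bot_le : ⊥ ≤ a)
  rw [hn.rank_eq, (hn.trans (.cons h (.refl b))).rank_eq]
  omega

theorem rank_bot {L : Type*} [Lattice L] [BoundedOrder L] : rank (⊥ : L) = 0 := by simp [rank]

theorem rank_strictMono : StrictMono (rank : L → ℕ) := fun a b hab => by
  obtain ⟨n, hn⟩ := CoverPath.exists_of_le (bot_le : ⊥ ≤ a)
  obtain ⟨k, hk⟩ := CoverPath.exists_of_le hab.le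
  rw [hn.rank_eq, (hn.trans hk).rank_eq]
  rcases hk with _ | _
  · exact absurd hab (lt_irrefl _)
  · omega

theorem covBy_sup_of_isAtom {L : Type*} [Lattice L] [BoundedOrder L]
    [IsUpperModularLattice L] {p a : L} (hp : IsAtom p) (hpa : ¬ p ≤ a) : a ⋖ p ⊔ a := by
  refine covBy_sup_of_inf_covBy_left ?_
  rw [(hp.not_le_iff_disjoint.1 hpa).eq_bot]
  exact hp.bot_covBy

end Rank

/-! ### Independent sets, circuits and faces. -/

section Faces

variable {L : Type*} [Lattice L] [BoundedOrder L]

theorem coe_le_sup {T : Finset (Point L)} {p : Point L} (hp : p ∈ T) :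
    (p : L) ≤ T.sup Subtype.val := Finset.le_sup (f := Subtype.val) hp

theorem sup_coe_mono {T U : Finset (Point L)} (h : U ⊆ T) :
    U.sup Subtype.val ≤ T.sup Subtype.val := Finset.sup_mono h

theorem indep_empty : Indep (∅ : Finset (Point L)) := by
  simp [Indep, setRank, rank_bot]

theorem setRank_insert_of_le [DecidableEq (Point L)] {T : Finset (Point L)} {p : Point L}
    (h : (p : L) ≤ T.sup Subtype.val) : setRank (insert p T) = setRank T := by
  rw [setRank, setRank, sup_insert, sup_eq_right.2 h]

theorem exists_circuit_subset {T : Finset (Point L)} (hT : ¬ Indep T) :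
    ∃ C ⊆ T, IsCircuit C := by
  obtain ⟨C, hC, hmin⟩ :=
    exists_minimal_le_of_wellFoundedLT (fun T : Finset (Point L) => ¬ Indep T) T hT
  exact ⟨C, hC, hmin⟩

theorem isBrokenCircuit_iff [DecidableEq (Point L)] {le : Point L → Point L → Prop}
    {B : Finset (Point L)} :
    IsBrokenCircuit le B ↔
      ∃ C, IsCircuit C ∧ ∃ p ∈ C, (∀ q ∈ C, le p q) ∧ B = C.erase p := by
  simp only [IsBrokenCircuit, ← coe_erase, coe_inj]

variable [Finite L] [IsUpperModularLattice L] {le : Point L → Point L → Prop}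

variable [DecidableEq (Point L)]

theorem setRank_insert_of_not_le {T : Finset (Point L)} {p : Point L}
    (h : ¬ (p : L) ≤ T.sup Subtype.val) : setRank (insert p T) = setRank T + 1 := by
  rw [setRank, setRank, sup_insert]
  exact rank_eq_of_covBy (covBy_sup_of_isAtom p.2 h)

theorem setRank_le_card (T : Finset (Point L)) : setRank T ≤ T.card := by
  induction T using Finset.induction_on with
  | empty => exact indep_empty.le
  | insert p T hp ih =>
    rw [card_insert_of_notMem hp]
    by_cases h : (p : L) ≤ T.sup Subtype.val
    · rw [setRank_insert_of_le h]; omega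
    · rw [setRank_insert_of_not_le h]; omega

theorem indep_insert_iff {T : Finset (Point L)} {p : Point L} (hp : p ∉ T) :
    Indep (insert p T) ↔ Indep T ∧ ¬ (p : L) ≤ T.sup Subtype.val := by
  have := setRank_le_card T
  rw [Indep, Indep, card_insert_of_notMem hp]
  by_cases h : (p : L) ≤ T.sup Subtype.val
  · rw [setRank_insert_of_le h]; simp only [h, not_true, and_false, iff_false]; omega
  · rw [setRank_insert_of_not_le h]; simp [h]

theorem Indep.subset {T U : Finset (Point L)} (hT : Indep T) (h : U ⊆ T) : Indep U := by
  induction T using Finset.induction_on generalizing U with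
  | empty => rwa [subset_empty.1 h]
  | insert p T hp ih =>
    have hT' := (indep_insert_iff hp).1 hT
    by_cases hpU : p ∈ U
    · rw [← insert_erase hpU, indep_insert_iff (notMem_erase p U)]
      have hsub : U.erase p ⊆ T := subset_insert_iff.1 h
      exact ⟨ih hT'.1 hsub, fun hle => hT'.2 (hle.trans (sup_coe_mono hsub))⟩
    · exact ih hT'.1 ((subset_insert_iff_of_notMem hpU).1 h)

theorem IsCircuit.le_sup_erase {C : Finset (Point L)} (hC : IsCircuit C) {q : Point L}
    (hq : q ∈ C) : (q : L) ≤ (C.erase q).sup Subtype.val := by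
  by_contra h
  have hind : Indep (C.erase q) := by
    by_contra hdep
    exact (erase_ssubset hq).not_ge (hC.2 hdep (erase_subset q C))
  exact hC.1 (insert_erase hq ▸ (indep_insert_iff (notMem_erase q C)).2 ⟨hind, h⟩)

theorem empty_mem_brokenCircuitComplex :
    (∅ : Finset (Point L)) ∈ brokenCircuitComplex le := by
  refine ⟨indep_empty, fun B hB hsub => ?_⟩
  obtain ⟨C, hC, p, hp, -, rfl⟩ := isBrokenCircuit_iff.1 hB
  have h := hC.le_sup_erase hp
  rw [subset_empty.1 hsub, sup_empty, le_bot_iff] at h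
  exact p.2.1 h

theorem mem_brokenCircuitComplex_of_subset {T U : Finset (Point L)}
    (hT : T ∈ brokenCircuitComplex le) (h : U ⊆ T) : U ∈ brokenCircuitComplex le :=
  ⟨hT.1.subset h, fun B hB hBU => hT.2 B hB (hBU.trans h)⟩

/-- The cone property: a circuit in `insert p T` would contain `p` as its least element, leaving a
broken circuit in `T`. -/
theorem insert_mem_brokenCircuitComplex [Std.Antisymm le] {T : Finset (Point L)} {a : L}
    (hT : T ∈ brokenCircuitComplex le) (hTa : T.sup Subtype.val ≤ a) {p : Point L}
    (hpa : (p : L) ≤ a) (hmin : ∀ q : Point L, (q : L) ≤ a → le p q) :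
    insert p T ∈ brokenCircuitComplex le := by
  have hins : (insert p T).sup Subtype.val ≤ a := by
    rw [sup_insert]
    exact sup_le hpa hTa
  have hle : ∀ q ∈ insert p T, (q : L) ≤ a := fun q hq => (coe_le_sup hq).trans hins
  refine ⟨?_, fun B hB hsub => ?_⟩
  · by_contra hdep
    obtain ⟨C, hCT, hC⟩ := exists_circuit_subset hdep
    have hpC : p ∈ C := by
      by_contra hpC
      exact hC.1 (hT.1.subset ((subset_insert_iff_of_notMem hpC).1 hCT))
    exact hT.2 (C.erase p) (isBrokenCircuit_iff.2
      ⟨C, hC, p, hpC, fun q hq => hmin q (hle q (hCT hq)), rfl⟩) (subset_insert_iff.1 hCT)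
  · have hpB : p ∈ B := by
      by_contra hpB
      exact hT.2 B hB ((subset_insert_iff_of_notMem hpB).1 hsub)
    obtain ⟨C, hC, q, hq, hqmin, rfl⟩ := isBrokenCircuit_iff.1 hB
    -- The deleted point lies below the join of the rest of its circuit, so it too competes with `p`
    -- for least point below `a`.
    have hqa : (q : L) ≤ a := (hC.le_sup_erase hq).trans ((sup_coe_mono hsub).trans hins)
    have hqp : p = q := Std.Antisymm.antisymm (r := le) p q (hmin q hqa)
      (hqmin p (mem_of_mem_erase hpB))
    exact notMem_erase q C (hqp ▸ hpB)

end Faces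

/-! ### Counting faces by their join. -/

section Counting

variable {L : Type*} [Lattice L] [BoundedOrder L] {le : Point L → Point L → Prop}

theorem exists_least_point [Finite L] [IsAtomic L] [IsLinearOrder (Point L) le] {a : L}
    (ha : a ≠ ⊥) : ∃ p : Point L, (p : L) ≤ a ∧ ∀ q : Point L, (q : L) ≤ a → le p q := by
  classical
  obtain ⟨p₀, hp₀, hp₀a⟩ := (eq_bot_or_exists_atom_le a).resolve_left ha
  let : LinearOrder (Point L) :=
    { le := le
      lt := fun p q => le p q ∧ ¬ le q p
      lt_iff_le_not_ge := fun _ _ => Iff.rfl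
      le_refl := refl_of le
      le_trans := fun _ _ _ => trans_of le
      le_antisymm := fun _ _ => antisymm_of le
      le_total := total_of le
      toDecidableLE := Classical.decRel le }
  obtain ⟨p, hp, hmin⟩ := Set.exists_min_image {p : Point L | (p : L) ≤ a} id
    (Set.toFinite _) ⟨⟨p₀, hp₀⟩, hp₀a⟩
  exact ⟨p, hp, hmin⟩

/-- Take `c ≤ a` maximal among elements not above `p`. For an atom `q ≤ a` outside `c`, maximality
puts `p` below `q ⊔ c`, which covers `c`, so `p ⊔ c = q ⊔ c`. -/
theorem exists_sup_eq_of_isAtom [Finite L] [IsUpperModularLattice L] [IsAtomistic L] {p a : L}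
    (hp : IsAtom p) (hpa : p ≤ a) : ∃ c < a, p ⊔ c = a := by
  obtain ⟨c, -, ⟨hca, hpc⟩, hmax⟩ := exists_maximal_ge_of_wellFoundedGT
    (fun c => c ≤ a ∧ ¬ p ≤ c) ⊥ ⟨bot_le, fun h => hp.1 (le_bot_iff.1 h)⟩
  refine ⟨c, hca.lt_of_ne fun h => hpc (h ▸ hpa), (sup_le hpa hca).antisymm ?_⟩
  refine le_iff_atom_le_imp.2 fun q hq hqa => ?_
  by_contra hqpc
  have hqc : ¬ q ≤ c := fun h => hqpc (h.trans le_sup_right)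
  have hcov := covBy_sup_of_isAtom hq hqc
  have hpq : p ≤ q ⊔ c := by
    by_contra hpq
    exact hcov.lt.not_ge (hmax ⟨sup_le hqa hca, hpq⟩ le_sup_right)
  have heq : p ⊔ c = q ⊔ c := (hcov.eq_or_eq le_sup_right (sup_le hpq le_sup_right)).resolve_left
    fun h => hpc (sup_eq_right.1 h)
  exact hqpc (heq ▸ le_sup_left)

theorem exists_face_sup_eq [Finite L] [IsUpperModularLattice L] [IsAtomistic L]
    [IsLinearOrder (Point L) le] (a : L) :
    ∃ T ∈ brokenCircuitComplex le, T.sup Subtype.val = a := by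
  classical
  induction a using WellFoundedLT.induction with
  | _ a ih =>
    by_cases ha : a = ⊥
    · exact ⟨∅, empty_mem_brokenCircuitComplex, by simp [ha]⟩
    obtain ⟨p, hpa, hmin⟩ := exists_least_point (le := le) ha
    obtain ⟨c, hca, hc⟩ := exists_sup_eq_of_isAtom p.2 hpa
    obtain ⟨T, hT, hTc⟩ := ih c hca
    exact ⟨insert p T, insert_mem_brokenCircuitComplex hT (hTc.trans_le hca.le) hpa hmin,
      by rw [sup_insert, hTc, hc]⟩

open scoped Classical in
theorem sum_neg_one_pow_card_faces_le [Fintype L] [DecidableEq L] [IsUpperModularLattice L]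
    [IsAtomistic L] [IsLinearOrder (Point L) le] (a : L) :
    ∑ T : Finset (Point L) with T ∈ brokenCircuitComplex le ∧ T.sup Subtype.val ≤ a,
      (-1 : ℤ) ^ T.card = if ⊥ = a then 1 else 0 := by
  split_ifs with ha
  · subst ha
    rw [sum_eq_single (∅ : Finset (Point L))]
    · simp
    · intro T hT hne
      obtain ⟨p, hp⟩ := nonempty_iff_ne_empty.2 hne
      exact absurd (le_bot_iff.1 ((coe_le_sup hp).trans (mem_filter.1 hT).2.2)) p.2.1
    · simp [empty_mem_brokenCircuitComplex]
  -- Toggling `p` is a sign-reversing involution without fixed points.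
  · obtain ⟨p, hpa, hmin⟩ := exists_least_point (le := le) (Ne.symm ha)
    refine sum_involution (fun T _ => if p ∈ T then T.erase p else insert p T) ?_ ?_ ?_ ?_
    · intro T _
      split_ifs with h
      · rw [← card_erase_add_one h, pow_succ]; ring
      · rw [card_insert_of_notMem h, pow_succ]; ring
    · intro T _ _
      split_ifs with h
      · exact fun heq => notMem_erase p T (heq.symm ▸ h)
      · exact fun heq => h (heq ▸ mem_insert_self p T)
    · intro T hT
      obtain ⟨hT, hTa⟩ := (mem_filter.1 hT).2
      refine mem_filter.2 ⟨mem_univ _, ?_⟩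
      split_ifs with h
      · exact ⟨mem_brokenCircuitComplex_of_subset hT (erase_subset p T),
          (sup_coe_mono (erase_subset p T)).trans hTa⟩
      · exact ⟨insert_mem_brokenCircuitComplex hT hTa hpa hmin,
          by rw [sup_insert]; exact sup_le hpa hTa⟩
    · intro T _
      by_cases h : p ∈ T <;> simp [h]

/-- The recursion has a unique solution: the sum over `Icc ⊥ a` fixes the value at `a` once all
smaller values are known. -/
theorem eq_mu_of_sum_Icc [Fintype L] [DecidableEq L] [LocallyFiniteOrder L] {f : L → ℤ}
    (hf : ∀ a, ∑ b ∈ Icc ⊥ a, f b = if ⊥ = a then 1 else 0) (a : L) :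
    f a = IncidenceAlgebra.mu ℤ ⊥ a := by
  induction a using WellFoundedLT.induction with
  | _ a ih =>
    have h := (hf a).trans (IncidenceAlgebra.sum_Icc_mu_right (𝕜 := ℤ) ⊥ a).symm
    rw [← Ico_insert_right bot_le, sum_insert right_notMem_Ico, sum_insert right_notMem_Ico,
      sum_congr rfl fun b hb => ih b (mem_Ico.1 hb).2] at h
    exact add_right_cancel h

open scoped Classical in
theorem card_faces_sup_eq [Fintype L] [DecidableEq L] [LocallyFiniteOrder L]
    [IsUpperModularLattice L] [IsAtomistic L] [IsLinearOrder (Point L) le] (a : L) :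
    (#{T : Finset (Point L) | T ∈ brokenCircuitComplex le ∧ T.sup Subtype.val = a} : ℤ) =
      (-1) ^ rank a * IncidenceAlgebra.mu ℤ ⊥ a := by
  have hsum (b : L) :
      ∑ T : Finset (Point L) with T ∈ brokenCircuitComplex le ∧ T.sup Subtype.val = b,
        (-1 : ℤ) ^ T.card =
      (-1) ^ rank b *
        #{T : Finset (Point L) | T ∈ brokenCircuitComplex le ∧ T.sup Subtype.val = b} := by
    rw [sum_congr rfl (g := fun _ => (-1 : ℤ) ^ rank b), sum_const, nsmul_eq_mul, mul_comm]
    intro T hT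
    obtain ⟨hface, hsup⟩ := (mem_filter.1 hT).2
    rw [← hface.1, setRank, hsup]
  have key := eq_mu_of_sum_Icc (f := fun b => (-1 : ℤ) ^ rank b *
    #{T : Finset (Point L) | T ∈ brokenCircuitComplex le ∧ T.sup Subtype.val = b}) ?_ a
  · rw [← key, ← mul_assoc, ← mul_pow]; simp
  · intro a
    rw [← sum_neg_one_pow_card_faces_le (le := le) a,
      ← sum_fiberwise_of_maps_to (t := Icc ⊥ a) (g := fun T : Finset (Point L) => T.sup Subtype.val)
        fun T hT => mem_Icc.2 ⟨bot_le, (mem_filter.1 hT).2.2⟩]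
    refine sum_congr rfl fun b hb => ?_
    rw [← hsum, filter_filter]
    refine sum_congr (filter_congr fun T _ => ?_) fun _ _ => rfl
    constructor
    · rintro ⟨h, rfl⟩
      exact ⟨⟨h, (mem_Icc.1 hb).2⟩, rfl⟩
    · exact fun h => ⟨h.1.1, h.2⟩

theorem ncard_faces_card_eq [Fintype L] [DecidableEq L] [LocallyFiniteOrder L]
    [IsUpperModularLattice L] [IsAtomistic L] [IsLinearOrder (Point L) le] (k : ℕ) :
    (({T ∈ brokenCircuitComplex le | T.card = k}.ncard : ℕ) : ℤ) =
      ∑ a : L with rank a = k, (-1) ^ k * IncidenceAlgebra.mu ℤ (⊥ : L) a := by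
  classical
  have hset : {T ∈ brokenCircuitComplex le | T.card = k} =
      (({T : Finset (Point L) | T ∈ brokenCircuitComplex le ∧ T.card = k} :
        Finset (Finset (Point L))) : Set (Finset (Point L))) := by
    ext; simp
  rw [hset, Set.ncard_coe_finset, card_eq_sum_card_fiberwise (t := {a : L | rank a = k})
    (f := fun T => T.sup Subtype.val), Nat.cast_sum]
  · refine sum_congr rfl fun a ha => ?_
    have hak : rank a = k := (mem_filter.1 ha).2
    subst hak
    refine Eq.trans ?_ (card_faces_sup_eq (le := le) a)
    rw [filter_filter]
    refine congrArg (fun s => (card s : ℤ)) (filter_congr fun T _ => ?_)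
    constructor
    · exact fun h => ⟨h.1.1, h.2⟩
    · rintro ⟨h, rfl⟩
      exact ⟨⟨h, h.1.symm⟩, rfl⟩
  · intro T hT
    simp only [coe_filter, mem_univ, true_and, Set.mem_ofPred_eq] at hT ⊢
    rw [← hT.2]
    exact hT.1.1

theorem card_le_rank_top [Finite L] [IsUpperModularLattice L] {T : Finset (Point L)}
    (hT : Indep T) : T.card ≤ rank (⊤ : L) :=
  hT.symm.trans_le (rank_strictMono.monotone le_top)

theorem topFaces_eq [Finite L] [IsUpperModularLattice L] [IsAtomistic L]
    [IsLinearOrder (Point L) le] :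
    topFaces le = {T ∈ brokenCircuitComplex le | T.card = rank (⊤ : L)} := by
  ext T
  constructor
  · rintro ⟨hT, hmax⟩
    obtain ⟨U, hU, hUtop⟩ := exists_face_sup_eq (le := le) (⊤ : L)
    refine ⟨hT, (card_le_rank_top hT.1).antisymm (le_trans ?_ (hmax U hU))⟩
    rw [← hU.1, setRank, hUtop]
  · rintro ⟨hT, hcard⟩
    exact ⟨hT, fun U hU => (card_le_rank_top hU.1).trans_eq hcard.symm⟩

end Counting

end GeometricLattice

theorem theorem15p1 {L : Type*} [Lattice L] [BoundedOrder L] [Fintype L] [DecidableEq L]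
    [LocallyFiniteOrder L] [GeometricLattice.IsGeometric L]
    (le : GeometricLattice.Point L → GeometricLattice.Point L → Prop)
    [IsLinearOrder (GeometricLattice.Point L) le] :
    (∀ k : ℕ,
      (({T ∈ GeometricLattice.brokenCircuitComplex le | T.card = k}.ncard : ℕ) : ℤ) =
        ∑ a : L with GeometricLattice.rank a = k, (-1) ^ k * IncidenceAlgebra.mu ℤ (⊥ : L) a) ∧
    (({T ∈ GeometricLattice.brokenCircuitComplex le |
          T.card = GeometricLattice.rank (⊤ : L)}.ncard : ℕ) : ℤ) =
        (-1) ^ GeometricLattice.rank (⊤ : L) * IncidenceAlgebra.mu ℤ (⊥ : L) ⊤ ∧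
    GeometricLattice.topFaces le =
      {T ∈ GeometricLattice.brokenCircuitComplex le |
        T.card = GeometricLattice.rank (⊤ : L)} ∧
    (((GeometricLattice.topFaces le).ncard : ℕ) : ℤ) =
        (-1) ^ GeometricLattice.rank (⊤ : L) * IncidenceAlgebra.mu ℤ (⊥ : L) ⊤ := by
  have htop : (({T ∈ GeometricLattice.brokenCircuitComplex le |
      T.card = GeometricLattice.rank (⊤ : L)}.ncard : ℕ) : ℤ) =
        (-1) ^ GeometricLattice.rank (⊤ : L) * IncidenceAlgebra.mu ℤ (⊥ : L) ⊤ := by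
    -- By strict monotonicity of rank, only `⊤` has full rank, so the sum has one term.
    rw [GeometricLattice.ncard_faces_card_eq,
      show ({a : L | GeometricLattice.rank a = GeometricLattice.rank (⊤ : L)} : Finset L) = {⊤} from
        Finset.ext fun a => ?_, Finset.sum_singleton]
    simp only [Finset.mem_filter, Finset.mem_univ, true_and, Finset.mem_singleton]
    refine ⟨fun h => ?_, fun h => h ▸ rfl⟩
    by_contra hne
    exact (GeometricLattice.rank_strictMono (lt_top_iff_ne_top.2 hne)).ne h
  exact ⟨GeometricLattice.ncard_faces_card_eq, htop, GeometricLattice.topFaces_eq,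
    GeometricLattice.topFaces_eq (le := le) ▸ htop⟩
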